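/- Let $\bar\mu$ be a probability measure on $\mathbb R^d$, $H=L^2(\bar\mu;\mathbb R^d)$, and let $\gamma$ be the law of a mean-zero Gaussian random element of $H$ whose covariance operator $\Gamma$ has nonzero eigenvalues $\lambda_1>\lambda_2>\dots>0$ (infinitely many, all simple). Let the pre-change tangent fields $v_1,v_2,\dots$ be i.i.d. with law $\gamma$. For each sample size $n_0$ put $$\bar v=\frac1{n_0}\sum_{t=1}^{n_0}v_t,\qquad \widehat C f=\frac1{n_0-1}\sum_{t=1}^{n_0}\langle f,v_t-\bar v\rangle_H\,(v_t-\bar v),$$ and let $(\widehat\lambda_m,\widehat\phi_m)_{m\ge1}$ be any (measurable) choice of eigenpairs of $\widehat C$, with $\widehat\lambda_1\ge\widehat\lambda_2\ge\dots\ge0$, the $\widehat\phi_m$ orthonormal, and $\widehat C=0$ on the orthogonal complement of the $\widehat\phi_m$. Let $v^\star$ (which may depend on $n_0$) be a new observation with law $\gamma$, independent of $v_1,\dots,v_{n_0}$, put $\Delta=v^\star-\bar v$, fix $K\ge 0$, and let $\widehat P_K$ be the orthogonal projection onto $\mathrm{span}\{\widehat\phi_1,\dots,\widehat\phi_K\}$.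 Define $$T^2_{K}=\sum_{m=1}^K\frac{\langle\Delta,\widehat\phi_m\rangle_H^2}{\widehat\lambda_m},\qquad \mathrm{SPE}=\|(I-\widehat P_K)\Delta\|_H^2$$ (terms with $\widehat\lambda_m=0$ being read as $0$). Let $Z_1,Z_2,\dots$ be i.i.d. $\mathcal N(0,1)$. Then $\sum_{m>K}\lambda_mZ_m^2$ converges almost surely, and as $n_0\to\infty$ $$T^2_{K}\xrightarrow{d}\chi^2_K,\qquad \mathrm{SPE}\xrightarrow{d}\sum_{m>K}\lambda_mZ_m^2,$$ and these hold simultaneously, that is, $(T^2_K,\mathrm{SPE})\xrightarrow{d}\bigl(\sum_{m\le K}Z_m^2,\ \sum_{m>K}\lambda_mZ_m^2\bigr)$. No consistency of the empirical eigenpairs is assumed separately. -/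

import Mathlib

open MeasureTheory ProbabilityTheory Filter Topology
open scoped RealInnerProductSpace ENNReal

noncomputable section

/-- The Hilbert space `L²(μ; ℝ^d)` of square-integrable vector fields. -/
abbrev FieldSpace (d : ℕ) (μ : Measure (EuclideanSpace ℝ (Fin d))) : Type :=
  Lp (EuclideanSpace ℝ (Fin d)) 2 μ

/-- `L²(μ; ℝ^d)` carries its Borel σ-algebra. -/
instance FieldSpace.instMeasurableSpace (d : ℕ) (μ : Measure (EuclideanSpace ℝ (Fin d))) :
    MeasurableSpace (FieldSpace d μ) := borel _

instance FieldSpace.instBorelSpace (d : ℕ) (μ : Measure (EuclideanSpace ℝ (Fin d))) :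
    BorelSpace (FieldSpace d μ) := ⟨rfl⟩

section Hilbert

variable {H : Type*} [NormedAddCommGroup H] [InnerProductSpace ℝ H]

/-- The mean of the first `n` fields `v 0, …, v (n - 1)`. -/
def sampleMean (v : ℕ → H) (n : ℕ) : H :=
  (n : ℝ)⁻¹ • ∑ t ∈ Finset.range n, v t

/-- The empirical covariance operator of the first `n` fields,
`f ↦ (n - 1)⁻¹ ∑ t < n, ⟪f, v t - v̄⟫ (v t - v̄)`. -/
def sampleCov (v : ℕ → H) (n : ℕ) : H →L[ℝ] H :=
  ((n : ℝ) - 1)⁻¹ • ∑ t ∈ Finset.range n,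
    InnerProductSpace.rankOne ℝ (v t - sampleMean v n) (v t - sampleMean v n)

/-- `(lam m, φ m)`, `m = 0, 1, …`, is a complete list of eigenpairs of the positive operator `C`:
the `φ m` are orthonormal eigenvectors, the eigenvalues `lam m ≥ 0` are listed in nonincreasing
order, and `C` vanishes on the orthogonal complement of the `φ m`, so that no nonzero eigenvalue
is left out. (The list is continued by zeros if `C` has finite rank.) -/
structure IsEigenSystem (C : H →L[ℝ] H) (lam : ℕ → ℝ) (φ : ℕ → H) : Prop where
  orthonormal : Orthonormal ℝ φ
  antitone : Antitone lam
  nonneg : ∀ m, 0 ≤ lam m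
  apply_eq : ∀ m, C (φ m) = lam m • φ m
  apply_eq_zero : ∀ f : H, (∀ m, ⟪f, φ m⟫ = 0) → C f = 0

/-- The truncated Hotelling statistic `∑ m < K, ⟪Δ, φ m⟫² / lam m`. -/
def hotelling (lam : ℕ → ℝ) (φ : ℕ → H) (K : ℕ) (Δ : H) : ℝ :=
  ∑ m ∈ Finset.range K, ⟪Δ, φ m⟫ ^ 2 / lam m

/-- The span of finitely many vectors is finite-dimensional, so it has an orthogonal projection. -/
instance spanFin.instHasOrthogonalProjection {K : ℕ} (e : Fin K → H) :
    (Submodule.span ℝ (Set.range e)).HasOrthogonalProjection :=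
  haveI : FiniteDimensional ℝ (Submodule.span ℝ (Set.range e)) :=
    FiniteDimensional.span_of_finite ℝ (Set.finite_range e)
  inferInstance

/-- The squared prediction error `‖(I - P_K) Δ‖²`, where `P_K` is the orthogonal projection onto
the span of the first `K` of the `φ m`. -/
def spe (φ : ℕ → H) (K : ℕ) (Δ : H) : ℝ :=
  ‖Δ - (Submodule.span ℝ (Set.range fun i : Fin K => φ i)).starProjection Δ‖ ^ 2

end Hilbert

/-- The `χ²` distribution with `K` degrees of freedom: the law of the sum of the squares of `K`
independent standard normal variables. -/
def chiSquared (K : ℕ) : Measure ℝ :=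
  (Measure.pi fun _ : Fin K => gaussianReal 0 1).map fun z => ∑ i, z i ^ 2

instance chiSquared.instIsProbabilityMeasure (K : ℕ) : IsProbabilityMeasure (chiSquared K) :=
  Measure.isProbabilityMeasure_map (by
    refine Measurable.aemeasurable ?_
    fun_prop)

end

/-! Both statistics are quadratic forms in `Δ`, of operators built from `λ̂ m` and the rank-one
projections `φ̂ m ⊗ φ̂ m`. The sign ambiguity of the eigenvectors therefore disappears, and it
suffices that these operators converge. The strong law, in `H` and in the space of operators, gives
`v̄ → 0` and `Ĉ → Γ` in operator norm, almost surely. Weyl's inequality (`IsEigenSystem.abs_sub_le`)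
then yields the eigenvalues, and the spectral gap (`IsEigenSystem.gap_mul_norm_sub_le`,
`IsEigenSystem.tendsto_rankOne`) the projections. Replacing the empirical operators by their limits
and `Δ` by `v⋆` costs at most `r n * (1 + ‖v⋆‖) ^ 2` with `r n → 0` almost surely. As the law of
`v⋆` is fixed, hence tight, the error vanishes in probability
(`tendstoInMeasure_zero_of_norm_le_mul`). The limiting forms at `v⋆` have exactly the target law for
every `n`: the standardised scores are i.i.d. standard normal (`hasLaw_scores`), and Parseval turns
the residual into the tail series. Slutsky's theorem concludes. -/

/-! ### Perturbation of eigenvalues and eigenprojections -/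

section Spectral

variable {H : Type*} [NormedAddCommGroup H] [InnerProductSpace ℝ H]

/-- An eigensystem of a symmetric operator extends to a Hilbert basis of eigenvectors. -/
lemma IsEigenSystem.exists_hilbertBasis [CompleteSpace H] {C : H →L[ℝ] H} {lam : ℕ → ℝ} {φ : ℕ → H}
    (h : IsEigenSystem C lam φ) (hC : ∀ x y, ⟪C x, y⟫ = ⟪x, C y⟫) :
    ∃ (w : Set H) (b : HilbertBasis w ℝ H) (μ : w → ℝ),
      (∀ m, ∃ i, b i = φ m) ∧
      (∀ i, (∃ m, b i = φ m ∧ μ i = lam m) ∨ (μ i = 0 ∧ ∀ m, ⟪b i, φ m⟫ = 0)) ∧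
      ∀ x i, ⟪C x, b i⟫ = μ i * ⟪x, b i⟫ := by
  obtain ⟨w, b, hw, hb⟩ := h.orthonormal.toSubtypeRange.exists_hilbertBasis_extension
  have key : ∀ i : w, ∃ μ : ℝ,
      ((∃ m, b i = φ m ∧ μ = lam m) ∨ (μ = 0 ∧ ∀ m, ⟪b i, φ m⟫ = 0)) ∧ C (b i) = μ • b i := by
    intro i
    by_cases hi : ∃ m, b i = φ m
    · obtain ⟨m, hm⟩ := hi
      exact ⟨lam m, Or.inl ⟨m, hm, rfl⟩, by rw [hm, h.apply_eq]⟩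
    -- Basis vectors outside the system are orthogonal to it, so they lie in the kernel.
    · push Not at hi
      have hort : ∀ m, ⟪b i, φ m⟫ = 0 := fun m => by
        have hm : φ m = b ⟨φ m, hw ⟨m, rfl⟩⟩ := by rw [hb]
        rw [hm]
        refine b.orthonormal.2 fun hij => hi m ?_
        rw [hij, hb]
      exact ⟨0, Or.inr ⟨rfl, hort⟩, by rw [zero_smul, h.apply_eq_zero _ hort]⟩
  choose μ hμ hμ' using key
  refine ⟨w, b, μ, fun m => ⟨⟨φ m, hw ⟨m, rfl⟩⟩, by rw [hb]⟩, hμ, fun x i => ?_⟩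
  rw [hC, hμ', inner_smul_right]

lemma HilbertBasis.hasSum_inner_sq {ι : Type*} (b : HilbertBasis ι ℝ H) (x : H) :
    HasSum (fun i => ⟪x, b i⟫ ^ 2) (‖x‖ ^ 2) := by
  have := b.hasSum_inner_mul_inner x x
  simpa [real_inner_self_eq_norm_sq, sq, real_inner_comm] using this

/-- The quadratic form is bounded by the `m`-th eigenvalue on the orthogonal complement of the
first `m` eigenvectors. -/
lemma IsEigenSystem.inner_apply_self_le [CompleteSpace H] {C : H →L[ℝ] H} {lam : ℕ → ℝ} {φ : ℕ → H}
    (h : IsEigenSystem C lam φ) (hC : ∀ x y, ⟪C x, y⟫ = ⟪x, C y⟫) {m : ℕ} {x : H}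
    (hx : ∀ j < m, ⟪x, φ j⟫ = 0) : ⟪C x, x⟫ ≤ lam m * ‖x‖ ^ 2 := by
  obtain ⟨w, b, μ, -, hμ, hCb⟩ := h.exists_hilbertBasis hC
  refine hasSum_le (fun i => ?_) (b.hasSum_inner_mul_inner (C x) x)
    ((b.hasSum_inner_sq x).mul_left (lam m))
  rw [hCb, real_inner_comm, mul_assoc, ← sq]
  rcases hμ i with ⟨j, hj, hμj⟩ | ⟨h0, -⟩
  · rcases lt_or_ge j m with hjm | hjm
    · simp [hj, hx j hjm, real_inner_comm]
    · rw [hμj, real_inner_comm]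
      exact mul_le_mul_of_nonneg_right (h.antitone hjm) (sq_nonneg _)
  · rw [h0, zero_mul]
    exact mul_nonneg (h.nonneg m) (sq_nonneg _)

/-- The quadratic form is at least the `m`-th eigenvalue on the span of the first `m + 1`
eigenvectors. -/
lemma IsEigenSystem.le_inner_apply_self {C : H →L[ℝ] H} {lam : ℕ → ℝ} {φ : ℕ → H}
    (h : IsEigenSystem C lam φ) {m : ℕ} (a : Fin (m + 1) → ℝ) :
    lam m * ‖∑ i, a i • φ i‖ ^ 2 ≤ ⟪C (∑ i, a i • φ i), ∑ i, a i • φ i⟫ := by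
  have ho : Orthonormal ℝ (fun i : Fin (m + 1) => φ i) :=
    h.orthonormal.comp _ Fin.val_injective
  have h1 : C (∑ i, a i • φ i) = ∑ i : Fin (m + 1), (a i * lam i) • φ i := by
    simp [map_sum, h.apply_eq, smul_smul]
  rw [h1, ← real_inner_self_eq_norm_sq, ho.inner_sum, ho.inner_sum, Finset.mul_sum]
  refine Finset.sum_le_sum fun i _ => ?_
  have := h.antitone (Nat.lt_succ_iff.1 i.2)
  simp only [conj_trivial]
  nlinarith [mul_self_nonneg (a i)]

/-- Dimension count: `m` linear conditions on `m + 1` coefficients. This supplies the test vector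
for Weyl's inequality. -/
lemma exists_ne_zero_forall_inner_sum_eq_zero {m : ℕ} (φ ψ : ℕ → H) :
    ∃ a : Fin (m + 1) → ℝ, a ≠ 0 ∧ ∀ j < m, ⟪∑ i, a i • φ i, ψ j⟫ = 0 := by
  let f : (Fin (m + 1) → ℝ) →ₗ[ℝ] (Fin m → ℝ) :=
    LinearMap.pi fun j => ((innerSL ℝ (ψ j)).toLinearMap ∘ₗ
      Fintype.linearCombination ℝ (fun i : Fin (m + 1) => φ i))
  have hf : LinearMap.ker f ≠ ⊥ := LinearMap.ker_ne_bot_of_finrank_lt (by simp)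
  obtain ⟨a, ha, ha0⟩ := (Submodule.ne_bot_iff _).1 hf
  refine ⟨a, ha0, fun j hj => ?_⟩
  have := congrFun (LinearMap.mem_ker.1 ha) ⟨j, hj⟩
  rw [real_inner_comm]
  simpa [f, Fintype.linearCombination_apply] using this

/-- **Weyl's inequality**, one half. -/
lemma IsEigenSystem.eigenvalue_le_add [CompleteSpace H] {C D : H →L[ℝ] H} {lam mu : ℕ → ℝ}
    {φ ψ : ℕ → H} (hC : IsEigenSystem C lam φ) (hD : IsEigenSystem D mu ψ)
    (hDs : ∀ x y, ⟪D x, y⟫ = ⟪x, D y⟫) (m : ℕ) : lam m ≤ mu m + ‖C - D‖ := by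
  -- At this `x` the Rayleigh quotient of `C` is at least `lam m` and that of `D` at most `mu m`;
  -- they differ by at most `‖C - D‖`.
  obtain ⟨a, ha, hx⟩ := exists_ne_zero_forall_inner_sum_eq_zero (m := m) φ ψ
  have ho : Orthonormal ℝ (fun i : Fin (m + 1) => φ i) :=
    hC.orthonormal.comp _ Fin.val_injective
  set x := ∑ i, a i • φ i with hxdef
  have hx0 : x ≠ 0 := fun h0 =>
    ha (funext (Fintype.linearIndependent_iff.1 ho.linearIndependent a h0))
  have h1 := hC.le_inner_apply_self a
  have h2 := hD.inner_apply_self_le hDs hx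
  have h3 : ⟪(C - D) x, x⟫ ≤ ‖C - D‖ * ‖x‖ ^ 2 := by
    calc ⟪(C - D) x, x⟫ ≤ ‖(C - D) x‖ * ‖x‖ := real_inner_le_norm _ _
      _ ≤ ‖C - D‖ * ‖x‖ * ‖x‖ := by gcongr; exact (C - D).le_opNorm x
      _ = _ := by ring
  rw [sub_apply, inner_sub_left] at h3
  have h4 : 0 < ‖x‖ ^ 2 := by positivity
  rw [← hxdef] at h1
  refine le_of_mul_le_mul_right ?_ h4
  linarith

/-- **Weyl's inequality** for the eigenvalues of two symmetric operators. -/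
lemma IsEigenSystem.abs_sub_le [CompleteSpace H] {C D : H →L[ℝ] H} {lam mu : ℕ → ℝ} {φ ψ : ℕ → H}
    (hC : IsEigenSystem C lam φ) (hD : IsEigenSystem D mu ψ)
    (hCs : ∀ x y, ⟪C x, y⟫ = ⟪x, C y⟫) (hDs : ∀ x y, ⟪D x, y⟫ = ⟪x, D y⟫) (m : ℕ) :
    |mu m - lam m| ≤ ‖D - C‖ := by
  have h1 := hC.eigenvalue_le_add hD hDs m
  have h2 := hD.eigenvalue_le_add hC hCs m
  rw [norm_sub_rev] at h1
  rw [abs_le]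
  constructor <;> linarith

/-- By monotonicity only the neighbours of `lam m` matter. The bound `δ ≤ lam m` separates it from
the eigenvalue `0` of the kernel as well. -/
lemma exists_spectral_gap {lam : ℕ → ℝ} (hlam : StrictAnti lam) (hpos : ∀ m, 0 < lam m) (m : ℕ) :
    ∃ δ, 0 < δ ∧ δ ≤ lam m ∧ ∀ i, i ≠ m → δ ≤ |lam i - lam m| := by
  have h1 : ∀ i, m < i → lam m - lam (m + 1) ≤ |lam i - lam m| := fun i hi => by
    have := hlam.antitone (Nat.succ_le_of_lt hi)
    rw [abs_sub_comm]
    exact (sub_le_sub_left this _).trans (le_abs_self _)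
  have h2 : 0 < lam m - lam (m + 1) := sub_pos.2 (hlam (Nat.lt_succ_self m))
  have h3 := hpos (m + 1)
  rcases m with - | k
  · exact ⟨_, h2, by linarith, fun i hi => h1 i (Nat.pos_of_ne_zero hi)⟩
  · refine ⟨min (lam (k + 1) - lam (k + 1 + 1)) (lam k - lam (k + 1)),
      lt_min h2 (sub_pos.2 (hlam (Nat.lt_succ_self k))), (min_le_left _ _).trans (by linarith),
      fun i hi => ?_⟩
    rcases lt_or_gt_of_ne hi with h | h
    · have := hlam.antitone (Nat.lt_succ_iff.1 h)
      exact (min_le_right _ _).trans ((sub_le_sub_right this _).trans (le_abs_self _))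
    · exact (min_le_left _ _).trans (h1 i h)

/-- A unit vector is close to an eigenvector with isolated eigenvalue when it almost satisfies
the eigenvalue equation. -/
lemma IsEigenSystem.gap_mul_norm_sub_le [CompleteSpace H] {C : H →L[ℝ] H} {lam : ℕ → ℝ} {φ : ℕ → H}
    (h : IsEigenSystem C lam φ) (hC : ∀ x y, ⟪C x, y⟫ = ⟪x, C y⟫) {m : ℕ} {δ : ℝ} (hδ : 0 ≤ δ)
    (hδm : δ ≤ lam m) (hgap : ∀ i, i ≠ m → δ ≤ |lam i - lam m|) (x : H) :
    δ * ‖x - ⟪x, φ m⟫ • φ m‖ ≤ ‖C x - lam m • x‖ := by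
  obtain ⟨w, b, μ, -, hμ, hCb⟩ := h.exists_hilbertBasis hC
  refine (sq_le_sq₀ (by positivity) (norm_nonneg _)).1 ?_
  rw [mul_pow]
  -- Parseval in an eigenbasis: `C - lam m` multiplies each coordinate off `φ m` by a factor of
  -- modulus at least `δ`.
  refine hasSum_le (fun i => ?_) ((b.hasSum_inner_sq _).mul_left (δ ^ 2)) (b.hasSum_inner_sq _)
  rw [inner_sub_left, inner_sub_left, inner_smul_left, inner_smul_left, hCb]
  simp only [conj_trivial]
  rcases hμ i with ⟨j, hj, hμj⟩ | ⟨h0, hi⟩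
  · rw [hj, hμj]
    rcases eq_or_ne j m with rfl | hjm
    · simp [h.orthonormal.1]
    · rw [h.orthonormal.2 hjm.symm, mul_zero, sub_zero, ← sub_mul, mul_pow, ← sq_abs (lam j - _)]
      gcongr
      exact hgap j hjm
  · rw [real_inner_comm, real_inner_comm _ (φ m), h0, hi m, mul_zero, zero_mul, sub_zero, zero_sub,
      neg_sq, mul_pow]
    gcongr

/-- Eigenvalues depend continuously on the symmetric operator. -/
lemma IsEigenSystem.tendsto_eigenvalue [CompleteSpace H] {ι : Type*} {l : Filter ι}
    {C : H →L[ℝ] H} {lam : ℕ → ℝ} {φ : ℕ → H} (h : IsEigenSystem C lam φ)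
    (hC : ∀ x y, ⟪C x, y⟫ = ⟪x, C y⟫) {D : ι → H →L[ℝ] H} {mu : ι → ℕ → ℝ} {ψ : ι → ℕ → H}
    (hD : ∀ n, IsEigenSystem (D n) (mu n) (ψ n)) (hDs : ∀ n x y, ⟪D n x, y⟫ = ⟪x, D n y⟫)
    (hlim : Tendsto D l (𝓝 C)) (m : ℕ) : Tendsto (fun n => mu n m) l (𝓝 (lam m)) := by
  rw [tendsto_iff_norm_sub_tendsto_zero] at hlim ⊢
  exact squeeze_zero (fun _ => norm_nonneg _)
    (fun n => h.abs_sub_le (hD n) hC (hDs n) m) hlim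

/-- The eigenprojections of simple isolated eigenvalues depend continuously on the symmetric
operator. -/
lemma IsEigenSystem.tendsto_rankOne [CompleteSpace H] {ι : Type*} {l : Filter ι}
    {C : H →L[ℝ] H} {lam : ℕ → ℝ} {φ : ℕ → H} (h : IsEigenSystem C lam φ)
    (hC : ∀ x y, ⟪C x, y⟫ = ⟪x, C y⟫) (hlam : StrictAnti lam) (hpos : ∀ m, 0 < lam m)
    {D : ι → H →L[ℝ] H} {mu : ι → ℕ → ℝ} {ψ : ι → ℕ → H}
    (hD : ∀ n, IsEigenSystem (D n) (mu n) (ψ n)) (hDs : ∀ n x y, ⟪D n x, y⟫ = ⟪x, D n y⟫)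
    (hlim : Tendsto D l (𝓝 C)) (m : ℕ) :
    Tendsto (fun n => InnerProductSpace.rankOne ℝ (ψ n m) (ψ n m)) l
      (𝓝 (InnerProductSpace.rankOne ℝ (φ m) (φ m))) := by
  obtain ⟨δ, hδ, hδm, hgap⟩ := exists_spectral_gap hlam hpos m
  set c : ι → ℝ := fun n => ⟪ψ n m, φ m⟫ with hc
  have hψ : ∀ n, ‖ψ n m‖ = 1 := fun n => (hD n).orthonormal.1 m
  have hφ : ‖φ m‖ = 1 := h.orthonormal.1 m
  have hnorm := tendsto_iff_norm_sub_tendsto_zero.1 hlim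
  have hres : Tendsto (fun n => ‖ψ n m - c n • φ m‖) l (𝓝 0) := by
    -- One `‖D n - C‖` comes from replacing `C` by `D n`, the other from Weyl's bound on `mu n m -
    -- lam m`.
    have hb : ∀ n, ‖ψ n m - c n • φ m‖ ≤ 2 * ‖D n - C‖ / δ := fun n => by
      rw [le_div_iff₀' hδ]
      refine (h.gap_mul_norm_sub_le hC hδ.le hδm hgap _).trans ?_
      have h1 : C (ψ n m) - lam m • ψ n m = -((D n - C) (ψ n m)) + (mu n m - lam m) • ψ n m := by
        rw [sub_apply, (hD n).apply_eq, sub_smul]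
        abel
      have h2 := h.abs_sub_le (hD n) hC (hDs n) m
      have h3 := (D n - C).le_opNorm (ψ n m)
      rw [hψ, mul_one] at h3
      rw [h1]
      refine (norm_add_le _ _).trans ?_
      rw [norm_neg, norm_smul, hψ, mul_one, Real.norm_eq_abs]
      linarith
    refine squeeze_zero (fun _ => norm_nonneg _) hb ?_
    simpa using (hnorm.const_mul 2).div_const δ
  -- Pythagoras. Only `c n ^ 2` can be shown to tend to `1`, since the sign of `ψ n m` is arbitrary.
  have hc2 : ∀ n, c n ^ 2 = 1 - ‖ψ n m - c n • φ m‖ ^ 2 := fun n => by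
    rw [norm_sub_sq_real, inner_smul_right, norm_smul, hψ, hφ, Real.norm_eq_abs, mul_one, sq_abs]
    simp only [hc]
    ring
  have hc_lim : Tendsto (fun n => c n ^ 2) l (𝓝 1) := by
    simp_rw [hc2]
    simpa using (hres.pow 2).const_sub 1
  have hc_abs : ∀ n, |c n| ≤ 1 := fun n => by
    simpa [hψ, hφ] using abs_real_inner_le_norm (ψ n m) (φ m)
  have hdiff : Tendsto (fun n => InnerProductSpace.rankOne ℝ (ψ n m) (ψ n m) -
      c n ^ 2 • InnerProductSpace.rankOne ℝ (φ m) (φ m)) l (𝓝 0) := by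
    refine squeeze_zero_norm (a := fun n => 2 * ‖ψ n m - c n • φ m‖) (fun n => ?_)
      (by simpa using hres.const_mul 2)
    have heq : InnerProductSpace.rankOne ℝ (ψ n m) (ψ n m) -
        c n ^ 2 • InnerProductSpace.rankOne ℝ (φ m) (φ m) =
        InnerProductSpace.rankOne ℝ (ψ n m) (ψ n m - c n • φ m) +
        InnerProductSpace.rankOne ℝ (ψ n m - c n • φ m) (c n • φ m) := by
      ext z
      simp only [sub_apply, add_apply,
        smul_apply, InnerProductSpace.rankOne_apply, inner_sub_left,
        inner_smul_left, conj_trivial]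
      module
    rw [heq]
    refine (norm_add_le _ _).trans ?_
    rw [InnerProductSpace.norm_rankOne, InnerProductSpace.norm_rankOne, hψ, norm_smul, hφ,
      Real.norm_eq_abs]
    nlinarith [hc_abs n, norm_nonneg (ψ n m - c n • φ m)]
  have := hdiff.add (hc_lim.smul_const (InnerProductSpace.rankOne ℝ (φ m) (φ m)))
  simpa using this

/-- The operator whose quadratic form is the truncated Hotelling statistic. -/
noncomputable def hotellingOp (lam : ℕ → ℝ) (φ : ℕ → H) (K : ℕ) : H →L[ℝ] H :=
  ∑ m ∈ Finset.range K, (lam m)⁻¹ • InnerProductSpace.rankOne ℝ (φ m) (φ m)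

/-- The operator whose quadratic form is the squared prediction error. -/
noncomputable def residualOp (φ : ℕ → H) (K : ℕ) : H →L[ℝ] H :=
  1 - ∑ m ∈ Finset.range K, InnerProductSpace.rankOne ℝ (φ m) (φ m)

lemma inner_hotellingOp (lam : ℕ → ℝ) (φ : ℕ → H) (K : ℕ) (x : H) :
    ⟪hotellingOp lam φ K x, x⟫ = hotelling lam φ K x := by
  simp only [hotellingOp, hotelling, sum_apply, smul_apply,
    InnerProductSpace.rankOne_apply, sum_inner, inner_smul_left, conj_trivial]
  refine Finset.sum_congr rfl fun m _ => ?_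
  rw [real_inner_comm x]
  ring

lemma inner_residualOp (φ : ℕ → H) (K : ℕ) (x : H) :
    ⟪residualOp φ K x, x⟫ = ‖x‖ ^ 2 - ∑ m ∈ Finset.range K, ⟪x, φ m⟫ ^ 2 := by
  simp only [residualOp, sum_apply, sub_apply,
    one_apply_eq_self, inner_sub_left, real_inner_self_eq_norm_sq,
    InnerProductSpace.rankOne_apply, sum_inner, inner_smul_left, conj_trivial]
  congr 1
  refine Finset.sum_congr rfl fun m _ => ?_
  rw [real_inner_comm x]
  ring

lemma spe_eq_inner_residualOp {φ : ℕ → H} (hφ : Orthonormal ℝ φ) (K : ℕ) (x : H) :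
    spe φ K x = ⟪residualOp φ K x, x⟫ := by
  have ho : Orthonormal ℝ (fun i : Fin K => φ i) := hφ.comp _ Fin.val_injective
  have hp : (Submodule.span ℝ (Set.range fun i : Fin K => φ i)).starProjection x =
      ∑ m ∈ Finset.range K, ⟪x, φ m⟫ • φ m := by
    refine Submodule.eq_starProjection_of_mem_of_inner_eq_zero ?_ ?_
    · exact Submodule.sum_mem _ fun m hm => Submodule.smul_mem _ _
        (Submodule.subset_span ⟨⟨m, Finset.mem_range.1 hm⟩, rfl⟩)
    · intro w hw
      induction hw using Submodule.span_induction with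
      | mem y hy =>
        obtain ⟨i, rfl⟩ := hy
        rw [inner_sub_left, sum_inner, Finset.sum_eq_single (i : ℕ)]
        · simp [inner_smul_left, hφ.1]
        · intro j _ hj
          simp [inner_smul_left, hφ.2 hj]
        · intro hi
          exact absurd (Finset.mem_range.2 i.2) hi
      | zero => simp
      | add y z _ _ hy hz => rw [inner_add_right, hy, hz, add_zero]
      | smul a y _ hy => rw [inner_smul_right, hy, mul_zero]
  rw [spe, hp, inner_residualOp, norm_sub_sq_real, inner_sum, ← real_inner_self_eq_norm_sq
    (∑ m ∈ Finset.range K, _), hφ.inner_sum]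
  simp only [inner_smul_right, conj_trivial]
  rw [Finset.mul_sum, sub_add, ← Finset.sum_sub_distrib]
  congr 1
  exact Finset.sum_congr rfl fun m _ => by ring

end Spectral

/-! ### Strong laws for the sample mean and covariance -/

section LawOfLargeNumbers

variable {H : Type*} [NormedAddCommGroup H] [InnerProductSpace ℝ H]

lemma inner_sampleCov_left (v : ℕ → H) (n : ℕ) (x y : H) :
    ⟪sampleCov v n x, y⟫ = ⟪x, sampleCov v n y⟫ := by
  simp only [sampleCov, smul_apply, sum_apply, InnerProductSpace.rankOne_apply, inner_smul_left,
    inner_smul_right, sum_inner, inner_sum, conj_trivial]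
  congr 1
  refine Finset.sum_congr rfl fun t _ => ?_
  rw [real_inner_comm x, mul_comm]

/-- Expanding the centring leaves an average of i.i.d. operators, to which the strong law applies.
At `n = 1` both sides vanish because division by `0` gives `0`. -/
lemma sampleCov_eq (v : ℕ → H) (n : ℕ) :
    sampleCov v n = ((n : ℝ) / (n - 1)) •
      ((n : ℝ)⁻¹ • ∑ t ∈ Finset.range n, InnerProductSpace.rankOne ℝ (v t) (v t) -
        InnerProductSpace.rankOne ℝ (sampleMean v n) (sampleMean v n)) := by
  rcases Nat.eq_zero_or_pos n with rfl | hn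
  · simp [sampleCov]
  have hn' : (n : ℝ) ≠ 0 := by positivity
  have hsum : ∑ t ∈ Finset.range n, v t = (n : ℝ) • sampleMean v n := by
    rw [sampleMean, smul_smul, mul_inv_cancel₀ hn', one_smul]
  have h : ∀ t, InnerProductSpace.rankOne ℝ (v t - sampleMean v n) (v t - sampleMean v n) =
      InnerProductSpace.rankOne ℝ (v t) (v t)
        - InnerProductSpace.rankOne ℝ (v t) (sampleMean v n)
        - InnerProductSpace.rankOne ℝ (sampleMean v n) (v t)
        + InnerProductSpace.rankOne ℝ (sampleMean v n) (sampleMean v n) := fun t => by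
    simp only [map_sub, sub_apply]
    abel
  have h1 : ∑ t ∈ Finset.range n, InnerProductSpace.rankOne ℝ (v t) (sampleMean v n) =
      (n : ℝ) • InnerProductSpace.rankOne ℝ (sampleMean v n) (sampleMean v n) := by
    rw [← sum_apply, ← map_sum, hsum, map_smul, smul_apply]
  have h2 : ∑ t ∈ Finset.range n, InnerProductSpace.rankOne ℝ (sampleMean v n) (v t) =
      (n : ℝ) • InnerProductSpace.rankOne ℝ (sampleMean v n) (sampleMean v n) := by
    rw [← map_sum, hsum, map_smulₛₗ, conj_trivial]
  rw [sampleCov]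
  simp_rw [h]
  rw [Finset.sum_add_distrib, Finset.sum_sub_distrib, Finset.sum_sub_distrib, h1, h2,
    Finset.sum_const, Finset.card_range, ← Nat.cast_smul_eq_nsmul ℝ, div_eq_inv_mul, mul_smul,
    smul_sub (n : ℝ), smul_smul (n : ℝ), mul_inv_cancel₀ hn', one_smul]
  congr 1
  abel

lemma continuous_rankOne_self :
    Continuous fun x : H => InnerProductSpace.rankOne ℝ x x :=
  (InnerProductSpace.rankOne (F := H) ℝ).continuous₂.comp (continuous_id.prodMk continuous_id)

variable [MeasurableSpace H] [BorelSpace H] [SecondCountableTopology H]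

lemma aestronglyMeasurable_rankOne_self (γ : Measure H) :
    AEStronglyMeasurable (fun x => InnerProductSpace.rankOne ℝ x x) γ :=
  -- The operator space need not be separable; separability of the domain suffices.
  haveI := secondCountableTopologyEither_of_left H (H →L[ℝ] H)
  continuous_rankOne_self.aestronglyMeasurable

lemma integrable_rankOne_self {γ : Measure H} (hγ : MemLp id 2 γ) :
    Integrable (fun x => InnerProductSpace.rankOne ℝ x x) γ := by
  refine (integrable_norm_iff (aestronglyMeasurable_rankOne_self γ)).1 ?_
  simpa [← sq] using hγ.integrable_norm_pow (by norm_num)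

variable [CompleteSpace H]

lemma integral_rankOne_self {γ : Measure H} (hγ : MemLp id 2 γ) :
    ∫ x, InnerProductSpace.rankOne ℝ x x ∂γ = covarianceOperator γ := by
  ext z
  rw [ContinuousLinearMap.integral_apply (integrable_rankOne_self hγ), covarianceOperator_apply hγ]
  simp [real_inner_comm]

variable {Ω : Type*} [MeasurableSpace Ω] {P : Measure Ω} {γ : Measure H} {v : ℕ → Ω → H}

lemma ae_tendsto_sampleMean (hγ : MemLp id 1 γ) (hv : ∀ t, HasLaw (v t) γ P)
    (hv_indep : iIndepFun v P) :
    ∀ᵐ ω ∂P, Tendsto (fun n => sampleMean (fun t => v t ω) n) atTop (𝓝 (∫ x, x ∂γ)) := by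
  have hint : Integrable (v 0) P := by
    have := memLp_one_iff_integrable.1 hγ
    rw [← (hv 0).map_eq] at this
    exact (integrable_map_measure aestronglyMeasurable_id (hv 0).aemeasurable).1 this
  have := strong_law_ae v hint (fun i j hij => hv_indep.indepFun hij)
    (fun i => ⟨(hv i).aemeasurable, (hv 0).aemeasurable, by rw [(hv i).map_eq, (hv 0).map_eq]⟩)
  rwa [(hv 0).integral_eq] at this

lemma ae_tendsto_sampleCov (hγ : MemLp id 2 γ) (hmean : ∫ x, x ∂γ = 0)
    (hv : ∀ t, HasLaw (v t) γ P) (hv_indep : iIndepFun v P) :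
    ∀ᵐ ω ∂P, Tendsto (fun n => sampleCov (fun t => v t ω) n) atTop
      (𝓝 (covarianceOperator γ)) := by
  have : IsProbabilityMeasure P := hv_indep.isProbabilityMeasure
  have : IsProbabilityMeasure γ := (hv 0).isProbabilityMeasure_iff.1 this
  borelize (H →L[ℝ] H)
  have hc := continuous_rankOne_self (H := H)
  have hint := integrable_rankOne_self hγ
  have hident : ∀ i, IdentDistrib (v i) (v 0) P P := fun i =>
    ⟨(hv i).aemeasurable, (hv 0).aemeasurable, by rw [(hv i).map_eq, (hv 0).map_eq]⟩
  have h1 := strong_law_ae (fun t ω => InnerProductSpace.rankOne ℝ (v t ω) (v t ω))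
    (by
      rw [← (hv 0).map_eq] at hint
      exact (integrable_map_measure (aestronglyMeasurable_rankOne_self _) (hv 0).aemeasurable).1 hint)
    (fun i j hij => (hv_indep.indepFun hij).comp hc.measurable hc.measurable)
    (fun i => (hident i).comp hc.measurable)
  have h2 : ∫ ω, InnerProductSpace.rankOne ℝ (v 0 ω) (v 0 ω) ∂P = covarianceOperator γ :=
    ((hv 0).integral_comp (aestronglyMeasurable_rankOne_self _)).trans (integral_rankOne_self hγ)
  rw [h2] at h1
  filter_upwards [h1, ae_tendsto_sampleMean (hγ.mono_exponent (by norm_num)) hv hv_indep]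
    with ω hω hmω
  simp_rw [sampleCov_eq]
  have h3 : Tendsto (fun n : ℕ => (n : ℝ) / (n - 1)) atTop (𝓝 1) := by
    simpa [sub_eq_add_neg] using tendsto_natCast_div_add_atTop (-1 : ℝ)
  rw [hmean] at hmω
  have h4 := h3.smul (hω.sub ((hc.tendsto 0).comp hmω))
  simpa using h4

end LawOfLargeNumbers

/-! ### Negligibility of the estimation error -/

section Slutsky

/-- The first factor is free of `x` and vanishes as `M' → M` and `u → 0`; only the second sees the
new observation. -/
lemma abs_inner_apply_sub_sub_inner_apply_le {H : Type*} [NormedAddCommGroup H]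
    [InnerProductSpace ℝ H] (M' M : H →L[ℝ] H) (x u : H) :
    |⟪M' (x - u), x - u⟫ - ⟪M x, x⟫| ≤
      (‖M' - M‖ * (1 + ‖u‖) ^ 2 + ‖M‖ * ‖u‖ * (2 + ‖u‖)) * (1 + ‖x‖) ^ 2 := by
  have hop : ∀ (A : H →L[ℝ] H) (y z : H), |⟪A y, z⟫| ≤ ‖A‖ * ‖y‖ * ‖z‖ := fun A y z =>
    (abs_real_inner_le_norm _ _).trans (by gcongr; exact A.le_opNorm y)
  have hx := norm_nonneg x
  have hu := norm_nonneg u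
  have h1 : |⟪(M' - M) (x - u), x - u⟫| ≤ ‖M' - M‖ * (1 + ‖u‖) ^ 2 * (1 + ‖x‖) ^ 2 := by
    have h2 : ‖x - u‖ ≤ (1 + ‖u‖) * (1 + ‖x‖) := (norm_sub_le _ _).trans (by nlinarith)
    calc _ ≤ ‖M' - M‖ * ‖x - u‖ * ‖x - u‖ := hop _ _ _
      _ ≤ ‖M' - M‖ * ((1 + ‖u‖) * (1 + ‖x‖)) * ((1 + ‖u‖) * (1 + ‖x‖)) := by gcongr
      _ = _ := by ring
  have h3 : |⟪M x, u⟫| + |⟪M u, x⟫| + |⟪M u, u⟫| ≤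
      ‖M‖ * ‖u‖ * (2 + ‖u‖) * (1 + ‖x‖) ^ 2 := by
    calc _ ≤ ‖M‖ * ‖x‖ * ‖u‖ + ‖M‖ * ‖u‖ * ‖x‖ + ‖M‖ * ‖u‖ * ‖u‖ := by gcongr <;> apply hop
      _ = ‖M‖ * ‖u‖ * (2 * ‖x‖ + ‖u‖) := by ring
      _ ≤ ‖M‖ * ‖u‖ * ((2 + ‖u‖) * (1 + ‖x‖) ^ 2) := by
        gcongr
        nlinarith [mul_nonneg hx hu, mul_nonneg hu (sq_nonneg ‖x‖), sq_nonneg ‖x‖]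
      _ = _ := by ring
  have h4 : ⟪M' (x - u), x - u⟫ - ⟪M x, x⟫ =
      ⟪(M' - M) (x - u), x - u⟫ - ⟪M x, u⟫ - ⟪M u, x⟫ + ⟪M u, u⟫ := by
    simp only [sub_apply, map_sub, inner_sub_left, inner_sub_right]
    ring
  rw [h4, add_mul]
  have h5 := abs_le.1 h1
  have h6 := abs_le.1 (le_refl |⟪M x, u⟫|)
  have h7 := abs_le.1 (le_refl |⟪M u, x⟫|)
  have h8 := abs_le.1 (le_refl |⟪M u, u⟫|)
  rw [abs_le]
  constructor <;> linarith [h5.1, h5.2, h6.1, h6.2, h7.1, h7.2, h8.1, h8.2]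

lemma exists_measure_lt_norm_le {H : Type*} [NormedAddCommGroup H] [MeasurableSpace H]
    [OpensMeasurableSpace H] (γ : Measure H) [IsFiniteMeasure γ] {δ : ℝ≥0∞} (hδ : 0 < δ) :
    ∃ c : ℕ, γ {x | (c : ℝ) < ‖x‖} ≤ δ := by
  have h := tendsto_measure_iInter_atTop (μ := γ) (s := fun c : ℕ => {x : H | (c : ℝ) < ‖x‖})
    (fun c => (measurableSet_lt measurable_const measurable_norm).nullMeasurableSet)
    (fun a b hab x (hx : (b : ℝ) < ‖x‖) =>
      show (a : ℝ) < ‖x‖ from lt_of_le_of_lt (Nat.cast_le.2 hab) hx)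
    ⟨0, measure_ne_top _ _⟩
  have h0 : ⋂ c : ℕ, {x : H | (c : ℝ) < ‖x‖} = ∅ := by
    ext x
    obtain ⟨c, hc⟩ := exists_nat_ge ‖x‖
    simp only [Set.mem_iInter, Set.mem_ofPred_eq, Set.mem_empty_iff_false, iff_false, not_forall,
      not_lt]
    exact ⟨c, hc⟩
  rw [h0, measure_empty] at h
  exact ((ENNReal.tendsto_nhds_zero.1 h) δ hδ).exists

/-- A sequence dominated by an almost surely vanishing factor times a function of variables with
a fixed law tends to zero in probability. -/
lemma tendstoInMeasure_zero_of_norm_le_mul {H E Ω : Type*} [NormedAddCommGroup H]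
    [MeasurableSpace H] [OpensMeasurableSpace H] [NormedAddCommGroup E] [MeasurableSpace Ω]
    {P : Measure Ω} [IsProbabilityMeasure P] {γ : Measure H} {x : ℕ → Ω → H}
    (hx : ∀ n, HasLaw (x n) γ P) {f : ℕ → Ω → E} (hf : ∀ n, AEStronglyMeasurable (f n) P)
    {r : ℕ → Ω → ℝ} (hr0 : ∀ n ω, 0 ≤ r n ω)
    (hr : ∀ᵐ ω ∂P, Tendsto (fun n => r n ω) atTop (𝓝 0))
    (hfr : ∀ n, ∀ᵐ ω ∂P, ‖f n ω‖ ≤ r n ω * (1 + ‖x n ω‖) ^ 2) :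
    TendstoInMeasure P f atTop 0 := by
  have : IsProbabilityMeasure γ := (hx 0).isProbabilityMeasure_iff.1 inferInstance
  rw [tendstoInMeasure_iff_norm]
  intro ε hε
  refine ENNReal.tendsto_nhds_zero.2 fun δ hδ => ?_
  obtain ⟨c, hc⟩ := exists_measure_lt_norm_le γ (ENNReal.half_pos hδ.ne')
  -- On `‖x n‖ ≤ c` the bound tends to zero almost surely, hence in measure; the complement has mass
  -- at most `δ / 2` for every `n`.
  set g : ℕ → Ω → E := fun n => {ω | ‖x n ω‖ ≤ c}.indicator (f n) with hg
  have hgm : ∀ n, AEStronglyMeasurable (g n) P := fun n =>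
    (hf n).indicator₀ (nullMeasurableSet_le (hx n).aemeasurable.norm aemeasurable_const)
  have hg0 : ∀ᵐ ω ∂P, Tendsto (fun n => g n ω) atTop (𝓝 ((0 : Ω → E) ω)) := by
    filter_upwards [hr, ae_all_iff.2 hfr] with ω hω hfω
    refine squeeze_zero_norm (a := fun n => r n ω * (1 + c) ^ 2) (fun n => ?_)
      (by simpa using hω.mul_const ((1 + (c : ℝ)) ^ 2))
    have := hr0 n ω
    by_cases hn : ω ∈ {ω | ‖x n ω‖ ≤ c}
    · simp only [hg, Set.indicator_of_mem hn]
      refine (hfω n).trans ?_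
      have hn' : ‖x n ω‖ ≤ c := hn
      gcongr
    · simp only [hg, Set.indicator_of_notMem hn, norm_zero]
      positivity
  have hgt := tendstoInMeasure_iff_norm.1 (tendstoInMeasure_of_tendsto_ae hgm hg0) ε hε
  filter_upwards [ENNReal.tendsto_nhds_zero.1 hgt _ (ENNReal.half_pos hδ.ne')] with n hn
  have hsub : {ω | ε ≤ ‖f n ω - (0 : Ω → E) ω‖} ⊆
      {ω | ε ≤ ‖g n ω - (0 : Ω → E) ω‖} ∪ {ω | (c : ℝ) < ‖x n ω‖} := by
    intro ω hω
    by_cases h : ‖x n ω‖ ≤ c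
    · left
      have : g n ω = f n ω := Set.indicator_of_mem (s := {ω | ‖x n ω‖ ≤ c}) h _
      simpa [this] using hω
    · exact Or.inr (not_le.1 h)
  calc _ ≤ _ := measure_mono hsub
    _ ≤ _ := measure_union_le _ _
    _ ≤ δ / 2 + δ / 2 := by
      gcongr
      rw [(hx n).measure_eq (p := fun y => (c : ℝ) < ‖y‖)
        (measurableSet_lt measurable_const measurable_norm)]
      exact hc
    _ = δ := ENNReal.add_halves δ

end Slutsky

/-! ### Gaussian scores and the exact limit law -/

section LimitLaw

/-- The pair of limit statistics as a function of the standardised scores. -/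
noncomputable def limitPair (lam : ℕ → ℝ) (K : ℕ) (z : ℕ → ℝ) : ℝ × ℝ :=
  (∑ m ∈ Finset.range K, z m ^ 2, ∑' m, lam (K + m) * z (K + m) ^ 2)

lemma measurable_limitPair (lam : ℕ → ℝ) (K : ℕ) : Measurable (limitPair lam K) := by
  unfold limitPair
  fun_prop

lemma measurableSet_summable_mul_sq (lam : ℕ → ℝ) (K : ℕ) :
    MeasurableSet {z : ℕ → ℝ | Summable fun m => lam (K + m) * z (K + m) ^ 2} :=
  measurableSet_exists_tendsto fun s => by fun_prop

/-- Orthonormal vectors are `√2` apart, so balls of radius `1 / 2` around them are disjoint. -/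
lemma Orthonormal.countable_of_separableSpace {H ι : Type*} [NormedAddCommGroup H]
    [InnerProductSpace ℝ H] [TopologicalSpace.SeparableSpace H] {b : ι → H}
    (hb : Orthonormal ℝ b) : Countable ι := by
  refine Pairwise.countable_of_isOpen_disjoint (s := fun i => Metric.ball (b i) (1 / 2))
    (fun i j hij => Metric.ball_disjoint_ball ?_) (fun _ => Metric.isOpen_ball)
    (fun i => ⟨b i, Metric.mem_ball_self (by norm_num)⟩)
  have h : dist (b i) (b j) ^ 2 = 2 := by
    rw [dist_eq_norm, norm_sub_sq_real, hb.1, hb.1, hb.2 hij]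
    norm_num
  nlinarith [dist_nonneg (x := b i) (y := b j)]

variable {H : Type*} [NormedAddCommGroup H] [InnerProductSpace ℝ H] [CompleteSpace H]
  [MeasurableSpace H] [BorelSpace H]

lemma inner_covarianceOperator_left (γ : Measure H) (x y : H) :
    ⟪covarianceOperator γ x, y⟫ = ⟪x, covarianceOperator γ y⟫ :=
  isPositive_covarianceOperator.1 x y

variable [SecondCountableTopology H]

lemma integral_inner_eq_zero {γ : Measure H} [IsGaussian γ] (hγ : ∫ x, x ∂γ = 0) (y : H) :
    ∫ x, ⟪x, y⟫ ∂γ = 0 := by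
  have := IsGaussian.integral_dual (μ := γ) (innerSL ℝ y)
  rw [hγ, map_zero] at this
  simpa [real_inner_comm] using this

lemma covariance_inner_inner {γ : Measure H} [IsGaussian γ] (hγ : ∫ x, x ∂γ = 0) (y z : H) :
    cov[fun x => ⟪x, y⟫, fun x => ⟪x, z⟫; γ] = ⟪covarianceOperator γ y, z⟫ := by
  rw [covarianceOperator_inner IsGaussian.memLp_two_id]
  simp only [covariance, integral_inner_eq_zero hγ, sub_zero]
  simp only [real_inner_comm]

/-- The `φ m` need not span `H`, but a direction in the kernel of the covariance has zero second
moment, so its coordinate vanishes almost surely. Countably many such directions complete the basis.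
-/
lemma ae_hasSum_inner_sq {γ : Measure H} (hγ : MemLp id 2 γ) {lam : ℕ → ℝ} {φ : ℕ → H}
    (hΓ : IsEigenSystem (covarianceOperator γ) lam φ) :
    ∀ᵐ x ∂γ, HasSum (fun m => ⟪x, φ m⟫ ^ 2) (‖x‖ ^ 2) := by
  obtain ⟨w, b, μ, he, hμ, hCb⟩ := hΓ.exists_hilbertBasis (inner_covarianceOperator_left γ)
  choose e he using he
  have hw : Countable w := b.orthonormal.countable_of_separableSpace
  have hzero : ∀ i : w, ∀ᵐ x ∂γ, i ∉ Set.range e → ⟪x, b i⟫ = 0 := fun i => by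
    by_cases hi : i ∈ Set.range e
    · exact ae_of_all _ fun x h => absurd hi h
    have hi0 : μ i = 0 := by
      rcases hμ i with ⟨m, hm, -⟩ | ⟨h0, -⟩
      · exact absurd ⟨m, b.orthonormal.linearIndependent.injective ((he m).trans hm.symm)⟩ hi
      · exact h0
    have hint : ∫ x, ⟪b i, x⟫ * ⟪b i, x⟫ ∂γ = 0 := by
      rw [← covarianceOperator_inner hγ, hCb, hi0, zero_mul]
    have hI : Integrable (fun x => ⟪b i, x⟫ * ⟪b i, x⟫) γ := by
      have h2 : MemLp (fun x => ⟪b i, x⟫) 2 γ := hγ.const_inner (b i)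
      exact h2.integrable_mul h2
    have := (integral_eq_zero_iff_of_nonneg (fun x => mul_self_nonneg _) hI).1 hint
    filter_upwards [this] with x hx _
    rw [real_inner_comm]
    exact mul_self_eq_zero.1 hx
  filter_upwards [ae_all_iff.2 hzero] with x hx
  have hinj : Function.Injective e := fun m n hmn =>
    hΓ.orthonormal.linearIndependent.injective (by rw [← he m, ← he n, hmn])
  have := (hinj.hasSum_iff (f := fun i => ⟪x, b i⟫ ^ 2)
    (fun i hi => by simp [hx i hi])).2 (b.hasSum_inner_sq x)
  simpa only [Function.comp_def, he] using this

/-- The standardised scores of a centred Gaussian element along the eigenvectors of its covariance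
operator are independent standard normal variables. -/
lemma hasLaw_scores {γ : Measure H} [IsGaussian γ] (hγ : ∫ x, x ∂γ = 0) {lam : ℕ → ℝ} {φ : ℕ → H}
    (hΓ : IsEigenSystem (covarianceOperator γ) lam φ) (hpos : ∀ m, 0 < lam m) :
    HasLaw (fun x m => (√(lam m))⁻¹ * ⟪x, φ m⟫)
      (Measure.infinitePi fun _ : ℕ => gaussianReal 0 1) γ := by
  have hcov : ∀ m n, cov[fun x => (√(lam m))⁻¹ * ⟪x, φ m⟫, fun x => (√(lam n))⁻¹ * ⟪x, φ n⟫; γ] =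
      if m = n then 1 else 0 := fun m n => by
    rw [covariance_const_mul_left, covariance_const_mul_right, covariance_inner_inner hγ,
      hΓ.apply_eq, inner_smul_left, conj_trivial]
    split_ifs with h
    · subst h
      rw [real_inner_self_eq_norm_sq, hΓ.orthonormal.1, one_pow, mul_one]
      have h1 := Real.mul_self_sqrt (hpos m).le
      have h2 := (Real.sqrt_pos.2 (hpos m)).ne'
      field_simp
      rw [sq, h1]
    · rw [hΓ.orthonormal.2 h]
      simp
  let L : ℕ → H →L[ℝ] ℝ := fun m => (√(lam m))⁻¹ • innerSL ℝ (φ m)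
  have hL : ∀ m x, L m x = (√(lam m))⁻¹ * ⟪x, φ m⟫ := fun m x => by
    simp [L, real_inner_comm]
  have hid : HasGaussianLaw (id : H → H) γ := IsGaussian.hasGaussianLaw_id
  have hlaw : ∀ m, HasLaw (fun x => (√(lam m))⁻¹ * ⟪x, φ m⟫) (gaussianReal 0 1) γ := fun m => by
    refine ⟨by fun_prop, ?_⟩
    have h1 : HasGaussianLaw (fun x => (√(lam m))⁻¹ * ⟪x, φ m⟫) γ := by
      simpa only [hL, id] using hid.map_fun (L m)
    rw [h1.map_eq_gaussianReal, integral_const_mul, integral_inner_eq_zero hγ, mul_zero,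
      ← covariance_self (by fun_prop), hcov, if_pos rfl, Real.toNNReal_one]
  refine iIndepFun.hasLaw_infinitePi hlaw ?_ (by fun_prop)
  -- Finite families of scores are jointly Gaussian, so uncorrelated implies independent.
  rw [iIndepFun_iff_finset]
  intro s
  refine HasGaussianLaw.iIndepFun_of_covariance_eq_zero ?_ fun i j hij => ?_
  · have := hid.map_fun (ContinuousLinearMap.pi fun i : s => L i)
    simp only [ContinuousLinearMap.coe_pi', hL, id] at this
    exact this
  · exact (hcov i j).trans (if_neg fun h => hij (Subtype.ext h))

/-- Weighting by `lam m` undoes the standardisation, and the Parseval tail is `‖x‖ ^ 2` minus its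
first `K` terms, the residual form. -/
lemma ae_summable_and_limitPair_scores {γ : Measure H} (hγ : MemLp id 2 γ) {lam : ℕ → ℝ}
    {φ : ℕ → H} (hΓ : IsEigenSystem (covarianceOperator γ) lam φ) (hpos : ∀ m, 0 < lam m) (K : ℕ) :
    ∀ᵐ x ∂γ, (Summable fun m => lam (K + m) * ((√(lam (K + m)))⁻¹ * ⟪x, φ (K + m)⟫) ^ 2) ∧
      limitPair lam K (fun m => (√(lam m))⁻¹ * ⟪x, φ m⟫) =
        (⟪hotellingOp lam φ K x, x⟫, ⟪residualOp φ K x, x⟫) := by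
  filter_upwards [ae_hasSum_inner_sq hγ hΓ] with x hx
  have h1 : ∀ m, ((√(lam m))⁻¹ * ⟪x, φ m⟫) ^ 2 = ⟪x, φ m⟫ ^ 2 / lam m := fun m => by
    rw [mul_pow, inv_pow, Real.sq_sqrt (hpos m).le, inv_mul_eq_div]
  have h2 : ∀ m, lam m * ((√(lam m))⁻¹ * ⟪x, φ m⟫) ^ 2 = ⟪x, φ m⟫ ^ 2 := fun m => by
    rw [h1, mul_div_cancel₀ _ (hpos m).ne']
  have h3 : HasSum (fun m => ⟪x, φ (K + m)⟫ ^ 2)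
      (‖x‖ ^ 2 - ∑ m ∈ Finset.range K, ⟪x, φ m⟫ ^ 2) := by
    simpa only [add_comm K] using (hasSum_nat_add_iff' K).2 hx
  refine ⟨by simpa only [h2] using h3.summable, ?_⟩
  rw [limitPair, inner_hotellingOp, inner_residualOp, hotelling]
  simp only [h2, h3.tsum_eq]
  simp only [h1]

end LimitLaw

/-! ### Convergence of the pair of statistics -/

section Limit

lemma TendstoInDistribution.of_identDistrib_limit {ι E Ω Ω' Ω'' : Type*} [TopologicalSpace E]
    [MeasurableSpace E] [OpensMeasurableSpace E] [MeasurableSpace Ω] [MeasurableSpace Ω']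
    [MeasurableSpace Ω''] {P : Measure Ω} [IsProbabilityMeasure P] {P' : Measure Ω'}
    [IsProbabilityMeasure P'] {P'' : Measure Ω''} [IsProbabilityMeasure P''] {l : Filter ι}
    {X : ι → Ω → E} {Z : Ω' → E} {W : Ω'' → E}
    (h : TendstoInDistribution X l Z (fun _ => P) P') (hZW : IdentDistrib Z W P' P'') :
    TendstoInDistribution X l W (fun _ => P) P'' where
  forall_aemeasurable := h.forall_aemeasurable
  aemeasurable_limit := hZW.aemeasurable_snd
  tendsto := by
    have h1 := h.tendsto
    simp only [hZW.map_eq] at h1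
    exact h1

lemma hasLaw_sum_sq_chiSquared {Ω : Type*} [MeasurableSpace Ω] {P : Measure Ω} {Z : ℕ → Ω → ℝ}
    (hZ : ∀ m, HasLaw (Z m) (gaussianReal 0 1) P) (hZ_indep : iIndepFun Z P) (K : ℕ) :
    HasLaw (fun ω => ∑ m ∈ Finset.range K, Z m ω ^ 2) (chiSquared K) P := by
  have h1 : HasLaw (fun ω (i : Fin K) => Z i ω) (Measure.pi fun _ : Fin K => gaussianReal 0 1) P :=
    iIndepFun.hasLaw_pi (fun i => hZ i) (hZ_indep.precomp Fin.val_injective)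
  have h2 : HasLaw (fun z : Fin K → ℝ => ∑ i, z i ^ 2) (chiSquared K)
      (Measure.pi fun _ : Fin K => gaussianReal 0 1) :=
    ⟨Measurable.aemeasurable (by fun_prop), rfl⟩
  simpa only [Finset.sum_range] using h2.fun_comp h1

variable {H : Type*} [NormedAddCommGroup H] [InnerProductSpace ℝ H]

lemma tendsto_hotellingOp {ι : Type*} {l : Filter ι} {lam : ℕ → ℝ} {φ : ℕ → H}
    (hpos : ∀ m, 0 < lam m) {mu : ι → ℕ → ℝ} {ψ : ι → ℕ → H}
    (hmu : ∀ m, Tendsto (fun n => mu n m) l (𝓝 (lam m)))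
    (hψ : ∀ m, Tendsto (fun n => InnerProductSpace.rankOne ℝ (ψ n m) (ψ n m)) l
      (𝓝 (InnerProductSpace.rankOne ℝ (φ m) (φ m)))) (K : ℕ) :
    Tendsto (fun n => hotellingOp (mu n) (ψ n) K) l (𝓝 (hotellingOp lam φ K)) :=
  tendsto_finsetSum _ fun m _ => ((hmu m).inv₀ (hpos m).ne').smul (hψ m)

lemma tendsto_residualOp {ι : Type*} {l : Filter ι} {φ : ℕ → H} {ψ : ι → ℕ → H}
    (hψ : ∀ m, Tendsto (fun n => InnerProductSpace.rankOne ℝ (ψ n m) (ψ n m)) l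
      (𝓝 (InnerProductSpace.rankOne ℝ (φ m) (φ m)))) (K : ℕ) :
    Tendsto (fun n => residualOp (ψ n) K) l (𝓝 (residualOp φ K)) :=
  tendsto_const_nhds.sub (tendsto_finsetSum _ fun m _ => hψ m)

lemma tendsto_slutsky_rate {l : Filter ℕ} {A : ℕ → H →L[ℝ] H} {B : H →L[ℝ] H} {u : ℕ → H}
    (hA : Tendsto A l (𝓝 B)) (hu : Tendsto u l (𝓝 0)) :
    Tendsto (fun n => ‖A n - B‖ * (1 + ‖u n‖) ^ 2 + ‖B‖ * ‖u n‖ * (2 + ‖u n‖)) l (𝓝 0) := by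
  have h1 := tendsto_iff_norm_sub_tendsto_zero.1 hA
  have h2 : Tendsto (fun n => ‖u n‖) l (𝓝 0) := by simpa using hu.norm
  have := (h1.mul ((h2.const_add 1).pow 2)).add ((h2.const_mul ‖B‖).mul (h2.const_add 2))
  simpa using this

variable [CompleteSpace H] [MeasurableSpace H] [BorelSpace H] [SecondCountableTopology H]

/-- The joint limit law of the Hotelling statistic and the squared prediction error for Gaussian
observations in a separable Hilbert space. -/
theorem tendstoInDistribution_hotelling_spe {γ : Measure H} [IsGaussian γ] (hγ : ∫ x, x ∂γ = 0)
    {lam : ℕ → ℝ} {φ : ℕ → H} (hΓ : IsEigenSystem (covarianceOperator γ) lam φ)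
    (hlam : StrictAnti lam) (hpos : ∀ m, 0 < lam m)
    {Ω : Type*} [MeasurableSpace Ω] {P : Measure Ω} [IsProbabilityMeasure P]
    {v : ℕ → Ω → H} (hv : ∀ t, HasLaw (v t) γ P) (hv_indep : iIndepFun v P)
    {vnew : ℕ → Ω → H} (hvnew : ∀ n, HasLaw (vnew n) γ P)
    {lamHat : ℕ → ℕ → Ω → ℝ} {φHat : ℕ → ℕ → Ω → H}
    (hlamHat : ∀ n m, AEMeasurable (lamHat n m) P) (hφHat : ∀ n m, AEMeasurable (φHat n m) P)
    (hHat : ∀ n, ∀ᵐ ω ∂P, IsEigenSystem (sampleCov (fun t => v t ω) n)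
      (fun m => lamHat n m ω) (fun m => φHat n m ω))
    (K : ℕ) {Ω' : Type*} [MeasurableSpace Ω'] {P' : Measure Ω'} [IsProbabilityMeasure P']
    {Z : ℕ → Ω' → ℝ}
    (hZ : HasLaw (fun ω m => Z m ω) (Measure.infinitePi fun _ : ℕ => gaussianReal 0 1) P') :
    TendstoInDistribution
      (fun n ω =>
        (hotelling (fun m => lamHat n m ω) (fun m => φHat n m ω) K
          (vnew n ω - sampleMean (fun t => v t ω) n),
        spe (fun m => φHat n m ω) K (vnew n ω - sampleMean (fun t => v t ω) n)))
      atTop (fun ω' => limitPair lam K (fun m => Z m ω')) (fun _ => P) P' := by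
  have hmem : MemLp id 2 γ := IsGaussian.memLp_two_id
  set F : H → ℝ × ℝ := fun x => (⟪hotellingOp lam φ K x, x⟫, ⟪residualOp φ K x, x⟫) with hF
  have hFm : Measurable F := by
    refine Continuous.measurable ?_
    fun_prop
  have hscore := hasLaw_scores hγ hΓ hpos
  have hG : Measurable (limitPair lam K) := measurable_limitPair lam K
  -- With the true operators and no centring, the pair has the limit law for every `n`.
  have hid : ∀ n, IdentDistrib (fun ω => F (vnew n ω)) (fun ω' => limitPair lam K fun m => Z m ω')
      P P' := fun n => by
    refine ⟨hFm.comp_aemeasurable (hvnew n).aemeasurable, hG.comp_aemeasurable hZ.aemeasurable, ?_⟩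
    have h1 : HasLaw F ((Measure.infinitePi fun _ : ℕ => gaussianReal 0 1).map (limitPair lam K))
        γ := by
      refine HasLaw.congr (HasLaw.fun_comp ⟨hG.aemeasurable, rfl⟩ hscore) ?_
      filter_upwards [ae_summable_and_limitPair_scores hmem hΓ hpos K] with x hx
      exact hx.2.symm
    have h2 : HasLaw (fun ω' => limitPair lam K fun m => Z m ω')
        ((Measure.infinitePi fun _ : ℕ => gaussianReal 0 1).map (limitPair lam K)) P' :=
      HasLaw.fun_comp ⟨hG.aemeasurable, rfl⟩ hZ
    rw [h2.map_eq, (h1.fun_comp (hvnew n)).map_eq]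
  have hX : TendstoInDistribution (fun n ω => F (vnew n ω)) atTop
      (fun ω' => limitPair lam K fun m => Z m ω') (fun _ => P) P' :=
    tendstoInDistribution_of_identDistrib 0 (fun j => (hid 0).trans (hid j).symm) (hid 0)
  set Δ : ℕ → Ω → H := fun n ω => vnew n ω - sampleMean (fun t => v t ω) n with hΔ
  have hΔm : ∀ n, AEMeasurable (Δ n) P := fun n => by
    have hvm : ∀ t, AEMeasurable (v t) P := fun t => (hv t).aemeasurable
    have : AEMeasurable (fun ω => sampleMean (fun t => v t ω) n) P := by
      unfold sampleMean
      fun_prop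
    exact (hvnew n).aemeasurable.sub this
  -- This form of the statistic is visibly measurable in `φHat`, unlike the projection onto a random
  -- span.
  have hspe : ∀ n, (fun ω => ‖Δ n ω‖ ^ 2 - ∑ m ∈ Finset.range K, ⟪Δ n ω, φHat n m ω⟫ ^ 2) =ᵐ[P]
      fun ω => spe (fun m => φHat n m ω) K (Δ n ω) := fun n => by
    filter_upwards [hHat n] with ω hω
    rw [spe_eq_inner_residualOp hω.orthonormal, inner_residualOp]
  have hYm : ∀ n, AEMeasurable (fun ω =>
      (hotelling (fun m => lamHat n m ω) (fun m => φHat n m ω) K (Δ n ω),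
        spe (fun m => φHat n m ω) K (Δ n ω))) P := fun n => by
    have h1 : ∀ m, AEMeasurable (fun ω => ⟪Δ n ω, φHat n m ω⟫) P := fun m =>
      (hΔm n).inner (hφHat n m)
    have hd := hΔm n
    refine AEMeasurable.prodMk ?_ (AEMeasurable.congr ?_ (hspe n))
    · unfold hotelling
      have hl := hlamHat n
      fun_prop
    · fun_prop
  refine tendstoInDistribution_of_tendstoInMeasure_sub _ _ hX ?_ hYm
  set M : ℕ → Ω → H →L[ℝ] H := fun n ω =>
    hotellingOp (fun m => lamHat n m ω) (fun m => φHat n m ω) K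
  set N : ℕ → Ω → H →L[ℝ] H := fun n ω => residualOp (fun m => φHat n m ω) K
  set u : ℕ → Ω → H := fun n ω => sampleMean (fun t => v t ω) n with hu
  set r : (ℕ → Ω → H →L[ℝ] H) → (H →L[ℝ] H) → ℕ → Ω → ℝ := fun A B n ω =>
    ‖A n ω - B‖ * (1 + ‖u n ω‖) ^ 2 + ‖B‖ * ‖u n ω‖ * (2 + ‖u n ω‖)
  have hr0 : ∀ A B n ω, 0 ≤ r A B n ω := fun A B n ω => by positivity
  refine tendstoInMeasure_zero_of_norm_le_mul hvnew
    (r := fun n ω => r M (hotellingOp lam φ K) n ω + r N (residualOp φ K) n ω)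
    (fun n => ((hYm n).sub (hid n).aemeasurable_fst).aestronglyMeasurable)
    (fun n ω => add_nonneg (hr0 _ _ _ _) (hr0 _ _ _ _)) ?_ fun n => ?_
  · filter_upwards [ae_all_iff.2 hHat, ae_tendsto_sampleCov hmem hγ hv hv_indep,
      ae_tendsto_sampleMean (hmem.mono_exponent (by norm_num)) hv hv_indep] with ω hω hcov hmean
    have hs := inner_covarianceOperator_left γ
    have hmu := hΓ.tendsto_eigenvalue hs hω (fun n => inner_sampleCov_left _ n) hcov
    have hψ := hΓ.tendsto_rankOne hs hlam hpos hω (fun n => inner_sampleCov_left _ n) hcov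
    rw [hγ] at hmean
    simpa using (tendsto_slutsky_rate (tendsto_hotellingOp hpos hmu hψ K) hmean).add
      (tendsto_slutsky_rate (tendsto_residualOp hψ K) hmean)
  · filter_upwards [hHat n] with ω hω
    have h1 := abs_inner_apply_sub_sub_inner_apply_le (M n ω) (hotellingOp lam φ K)
      (vnew n ω) (u n ω)
    have h2 := abs_inner_apply_sub_sub_inner_apply_le (N n ω) (residualOp φ K) (vnew n ω) (u n ω)
    rw [inner_hotellingOp (fun m => lamHat n m ω)] at h1
    rw [← spe_eq_inner_residualOp hω.orthonormal] at h2
    rw [add_mul]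
    -- The norm on `ℝ × ℝ` is the maximum, so each component's rate is bounded by the sum of both.
    exact max_le (h1.trans (le_add_of_nonneg_right (mul_nonneg (hr0 _ _ _ _) (sq_nonneg _))))
      (h2.trans (le_add_of_nonneg_left (mul_nonneg (hr0 _ _ _ _) (sq_nonneg _))))

end Limit

/-! ### The theorem for `L²(μbar; ℝ^d)` -/

theorem mainTheorem4 {d : ℕ}
    -- the reference measure, and `H = L²(μbar; ℝ^d)`
    (μbar : Measure (EuclideanSpace ℝ (Fin d))) [IsProbabilityMeasure μbar]
    -- the law of a pre-change tangent field: mean-zero Gaussian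
    (γ : Measure (FieldSpace d μbar)) [IsGaussian γ] (hγ : ∫ x, x ∂γ = 0)
    -- its covariance operator has eigenvalues `lam 0 > lam 1 > … > 0`
    (lam : ℕ → ℝ) (φ : ℕ → FieldSpace d μbar)
    (hΓ : IsEigenSystem (covarianceOperator γ) lam φ)
    (hlam : StrictAnti lam) (hlam_pos : ∀ m, 0 < lam m)
    -- the i.i.d. pre-change fields
    {Ω : Type*} [MeasurableSpace Ω] (P : Measure Ω) [IsProbabilityMeasure P]
    (v : ℕ → Ω → FieldSpace d μbar) (hv : ∀ t, HasLaw (v t) γ P) (hv_indep : iIndepFun v P)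
    -- for each sample size `n`, a new pre-change observation, independent of the sample
    (vnew : ℕ → Ω → FieldSpace d μbar) (hvnew : ∀ n, HasLaw (vnew n) γ P)
    (hvnew_indep : ∀ n, IndepFun (vnew n) (fun ω (t : Fin n) => v t ω) P)
    -- for each sample size `n`, the empirical eigenpairs
    (lamHat : ℕ → ℕ → Ω → ℝ) (φHat : ℕ → ℕ → Ω → FieldSpace d μbar)
    (hlamHat : ∀ n m, AEMeasurable (lamHat n m) P) (hφHat : ∀ n m, AEMeasurable (φHat n m) P)
    (hHat : ∀ n, ∀ᵐ ω ∂P, IsEigenSystem (sampleCov (fun t => v t ω) n)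
      (fun m => lamHat n m ω) (fun m => φHat n m ω))
    -- the truncation level
    (K : ℕ)
    -- i.i.d. standard normal variables, for the limit laws
    {Ω' : Type*} [MeasurableSpace Ω'] (P' : Measure Ω') [IsProbabilityMeasure P']
    (Z : ℕ → Ω' → ℝ) (hZ : ∀ m, HasLaw (Z m) (gaussianReal 0 1) P') (hZ_indep : iIndepFun Z P') :
    -- the Hotelling statistic
    TendstoInDistribution
      (fun n ω => hotelling (fun m => lamHat n m ω) (fun m => φHat n m ω) K
        (vnew n ω - sampleMean (fun t => v t ω) n))
      atTop id (fun _ => P) (chiSquared K) ∧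
    -- the limit series of the residual statistic converges
    (∀ᵐ ω' ∂P', Summable fun m => lam (K + m) * Z (K + m) ω' ^ 2) ∧
    -- the residual statistic
    TendstoInDistribution
      (fun n ω => spe (fun m => φHat n m ω) K (vnew n ω - sampleMean (fun t => v t ω) n))
      atTop (fun ω' => ∑' m, lam (K + m) * Z (K + m) ω' ^ 2) (fun _ => P) P' ∧
    -- both at the same time
    TendstoInDistribution
      (fun n ω =>
        (hotelling (fun m => lamHat n m ω) (fun m => φHat n m ω) K
          (vnew n ω - sampleMean (fun t => v t ω) n),
        spe (fun m => φHat n m ω) K (vnew n ω - sampleMean (fun t => v t ω) n)))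
      atTop
      (fun ω' => (∑ m ∈ Finset.range K, Z m ω' ^ 2, ∑' m, lam (K + m) * Z (K + m) ω' ^ 2))
      (fun _ => P) P' := by
  have : Fact ((2 : ℝ≥0∞) ≠ ∞) := ⟨ENNReal.ofNat_ne_top⟩
  have : SecondCountableTopology (FieldSpace d μbar) := Lp.SecondCountableTopology
  have hZlaw : HasLaw (fun ω' m => Z m ω') (Measure.infinitePi fun _ : ℕ => gaussianReal 0 1) P' :=
    hZ_indep.hasLaw_infinitePi hZ (aemeasurable_pi_lambda _ fun m => (hZ m).aemeasurable)
  have hjoint := tendstoInDistribution_hotelling_spe hγ hΓ hlam hlam_pos hv hv_indep hvnew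
    hlamHat hφHat hHat K hZlaw
  have hT := hjoint.continuous_comp continuous_fst
  have hS := hjoint.continuous_comp continuous_snd
  have hchi := hasLaw_sum_sq_chiSquared hZ hZ_indep K
  refine ⟨TendstoInDistribution.of_identDistrib_limit hT ?_, ?_, hS, hjoint⟩
  · exact ⟨hT.aemeasurable_limit, aemeasurable_id, by rw [Measure.map_id]; exact hchi.map_eq⟩
  -- Summability is a measurable event in sequence space, and `Z` has the law of the scores under
  -- `γ`, where Parseval gives it.
  · have hm := measurableSet_summable_mul_sq lam K
    refine (hZlaw.ae_iff (p := fun z => Summable fun m => lam (K + m) * z (K + m) ^ 2)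
      (measurableSet_setOfPred.1 hm)).2 ?_
    rw [← (hasLaw_scores hγ hΓ hlam_pos).ae_iff (measurableSet_setOfPred.1 hm)]
    filter_upwards [ae_summable_and_limitPair_scores IsGaussian.memLp_two_id hΓ hlam_pos K]
      with x hx
    exact hx.1
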